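/- Let $A$ and $B$ be C*-algebras, $M_1$ a Hilbert $A$-module and $M_2$ a Hilbert $B$-module. Let $A\otimes B$ be the minimal (spatial) tensor product, and let $M_1\otimes M_2$ be the external tensor product, i.e. the Hilbert $A\otimes B$-module obtained by completing the algebraic tensor product $M_1\odot M_2$ in the norm induced by the $A\otimes B$-valued inner product determined by $\langle x\otimes y,\,x'\otimes y'\rangle=\langle x,x'\rangle\otimes\langle y,y'\rangle$. For a Hilbert C*-module $E$ and a closed submodule $X\subseteq E$, write $X\subset\subset E$ if $X$ and $E$ are countably generated and there is a compact self-adjoint endomorphism $b$ of $E$ with $b x=x$ for all $x\in X$; here the compact endomorphisms are the norm closure of the linear span of the operators $z\mapsto x\langle y,z\rangle$ with $x,y\in E$. Call $E$ a compact element if $E\subset\subset E$. If $M_1$ and $M_2$ are compact elements, then the Hilbert $A\otimes B$-module $M_1\otimes M_2$ is a compact element. -/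

import Mathlib

noncomputable section

open scoped TensorProduct ComplexOrder InnerProductSpace ENNReal
open UniformSpace

universe u v

/-- The Hilbert space tensor product `H ⊗ K`: the completion of the algebraic tensor product. -/
def HilbertTensor (H : Type u) (K : Type v) [NormedAddCommGroup H] [InnerProductSpace ℂ H]
    [NormedAddCommGroup K] [InnerProductSpace ℂ K] : Type (max u v) :=
  Completion (H ⊗[ℂ] K)

namespace HilbertTensor

variable {H : Type u} {K : Type v} [NormedAddCommGroup H] [InnerProductSpace ℂ H]
    [NormedAddCommGroup K] [InnerProductSpace ℂ K]

instance : NormedAddCommGroup (HilbertTensor H K) :=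
  inferInstanceAs (NormedAddCommGroup (Completion (H ⊗[ℂ] K)))
instance : InnerProductSpace ℂ (HilbertTensor H K) :=
  inferInstanceAs (InnerProductSpace ℂ (Completion (H ⊗[ℂ] K)))
instance : CompleteSpace (HilbertTensor H K) :=
  inferInstanceAs (CompleteSpace (Completion (H ⊗[ℂ] K)))

/-- The canonical isometric embedding of the algebraic tensor product. -/
def incl : H ⊗[ℂ] K →ₗᵢ[ℂ] HilbertTensor H K := Completion.toComplₗᵢ

theorem denseRange_incl : DenseRange (incl (H := H) (K := K)) := Completion.denseRange_coe

@[elab_as_elim]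
theorem induction_on {p : HilbertTensor H K → Prop} (ξ : HilbertTensor H K)
    (hp : IsClosed {x | p x}) (h : ∀ t : H ⊗[ℂ] K, p (incl t)) : p ξ :=
  Completion.induction_on ξ hp h

theorem inner_incl_tmul (x x' : H) (y y' : K) :
    ⟪incl (x ⊗ₜ[ℂ] y), incl (x' ⊗ₜ[ℂ] y')⟫_ℂ = ⟪x, x'⟫_ℂ * ⟪y, y'⟫_ℂ := by
  rw [LinearIsometry.inner_map_map, TensorProduct.inner_tmul]

theorem ext_op {S T : HilbertTensor H K →L[ℂ] HilbertTensor H K}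
    (h : ∀ x y, S (incl (x ⊗ₜ[ℂ] y)) = T (incl (x ⊗ₜ[ℂ] y))) : S = T := by
  ext ξ
  induction ξ using induction_on with
  | hp => exact isClosed_eq S.continuous T.continuous
  | h ξ =>
    induction ξ with
    | zero => simp
    | tmul x y => exact h x y
    | add x y hx hy => simp only [map_add, hx, hy]

/-- The bounded operator `S ⊗ T` on `H ⊗ K`. -/
def op (S : H →L[ℂ] H) (T : K →L[ℂ] K) : HilbertTensor H K →L[ℂ] HilbertTensor H K :=
  (TensorProduct.mapL S T).completion

@[simp]
theorem op_incl_tmul (S : H →L[ℂ] H) (T : K →L[ℂ] K) (x : H) (y : K) :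
    op S T (incl (x ⊗ₜ[ℂ] y)) = incl (S x ⊗ₜ[ℂ] T y) := by
  have := (TensorProduct.mapL S T).completion_apply_coe (x ⊗ₜ[ℂ] y)
  rw [TensorProduct.mapL_tmul] at this
  exact this

theorem norm_op_le (S : H →L[ℂ] H) (T : K →L[ℂ] K) : ‖op S T‖ ≤ ‖S‖ * ‖T‖ := by
  refine ContinuousLinearMap.opNorm_le_bound _ (by positivity) fun ξ => ?_
  induction ξ using induction_on with
  | hp => exact isClosed_le (by fun_prop) (by fun_prop)
  | h ξ =>
    have h1 : op S T (incl ξ) = incl (TensorProduct.mapL S T ξ) :=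
      (TensorProduct.mapL S T).completion_apply_coe ξ
    rw [h1, LinearIsometry.norm_map, LinearIsometry.norm_map]
    refine (ContinuousLinearMap.le_opNorm _ _).trans ?_
    gcongr
    exact TensorProduct.norm_mapL_le _ _

theorem op_mul (S S' : H →L[ℂ] H) (T T' : K →L[ℂ] K) :
    op (S * S') (T * T') = op S T * op S' T' :=
  ext_op fun x y => by simp

theorem op_star [CompleteSpace H] [CompleteSpace K] (S : H →L[ℂ] H) (T : K →L[ℂ] K) :
    op (star S) (star T) = star (op S T) := by
  rw [ContinuousLinearMap.star_eq_adjoint (op S T)]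
  refine (ContinuousLinearMap.eq_adjoint_iff _ _).mpr fun ξ η => ?_
  induction ξ using induction_on with
  | hp => apply isClosed_eq <;> fun_prop
  | h ξ =>
    induction η using induction_on with
    | hp => apply isClosed_eq <;> fun_prop
    | h η =>
      induction ξ with
      | zero => simp
      | add ξ ξ' h h' => simp only [map_add, inner_add_left, h, h']
      | tmul x y =>
        induction η with
        | zero => simp
        | add η η' h h' => simp only [map_add, inner_add_right, h, h']
        | tmul x' y' =>
          simp [ContinuousLinearMap.star_eq_adjoint,
            ContinuousLinearMap.adjoint_inner_left]

/-- `(S, T) ↦ S ⊗ T` as a bilinear map. -/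
def opBilin : (H →L[ℂ] H) →ₗ[ℂ] (K →L[ℂ] K) →ₗ[ℂ]
    (HilbertTensor H K →L[ℂ] HilbertTensor H K) :=
  LinearMap.mk₂ ℂ op
    (fun S S' T => ext_op fun x y => by simp [TensorProduct.add_tmul])
    (fun c S T => ext_op fun x y => by
      rw [op_incl_tmul, smul_apply, ← TensorProduct.smul_tmul', map_smul,
        smul_apply, op_incl_tmul])
    (fun S T T' => ext_op fun x y => by simp [TensorProduct.tmul_add])
    (fun c S T => ext_op fun x y => by simp)

variable [CompleteSpace H] [CompleteSpace K]
  {A B : Type*} [NonUnitalCStarAlgebra A] [NonUnitalCStarAlgebra B]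

/-- The representation `π ⊗ ρ` of the algebraic tensor product `A ⊙ B` on `H ⊗ K`. -/
def rep (π : A →⋆ₙₐ[ℂ] (H →L[ℂ] H)) (ρ : B →⋆ₙₐ[ℂ] (K →L[ℂ] K)) :
    A ⊗[ℂ] B →⋆ₙₐ[ℂ] (HilbertTensor H K →L[ℂ] HilbertTensor H K) :=
  let L : A ⊗[ℂ] B →ₗ[ℂ] (HilbertTensor H K →L[ℂ] HilbertTensor H K) :=
    TensorProduct.lift (opBilin.compl₁₂ (π : A →ₗ[ℂ] (H →L[ℂ] H)) (ρ : B →ₗ[ℂ] (K →L[ℂ] K)))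
  have hL : ∀ a b, L (a ⊗ₜ b) = op (π a) (ρ b) := fun a b => rfl
  { L with
    map_zero' := map_zero L
    map_mul' := fun s t => by
      change L (s * t) = L s * L t
      induction s with
      | zero => simp
      | add s s' hs hs' => simp only [add_mul, map_add, hs, hs']
      | tmul a b =>
        induction t with
        | zero => simp
        | add t t' ht ht' => simp only [mul_add, map_add, ht, ht']
        | tmul a' b' =>
          rw [Algebra.TensorProduct.tmul_mul_tmul, hL, hL, hL, map_mul, map_mul, op_mul]
    map_star' := fun s => by
      change L (star s) = star (L s)
      induction s with
      | zero => simp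
      | add s s' hs hs' => simp only [star_add, map_add, hs, hs']
      | tmul a b => rw [TensorProduct.star_tmul, hL, hL, map_star, map_star, op_star] }

theorem rep_tmul (π : A →⋆ₙₐ[ℂ] (H →L[ℂ] H)) (ρ : B →⋆ₙₐ[ℂ] (K →L[ℂ] K)) (a : A) (b : B) :
    rep π ρ (a ⊗ₜ b) = op (π a) (ρ b) := rfl

end HilbertTensor

section Family

variable {I : Type*} {F : I → Type*} [∀ i, NonUnitalCStarAlgebra (F i)]

/-- The C⋆-algebra of bounded families `(x i)` with `x i ∈ F i`. -/
def BddFamily (F : I → Type*) [∀ i, NonUnitalCStarAlgebra (F i)] : Type _ := lp F ∞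

instance : NonUnitalCStarAlgebra (BddFamily F) :=
  inferInstanceAs (NonUnitalCStarAlgebra (lp F ∞))

/-- The member with index `i` of a family. -/
def BddFamily.proj (i : I) : BddFamily F →⋆ₙₐ[ℂ] F i where
  toFun x := x.1 i
  map_smul' _ _ := rfl
  map_zero' := rfl
  map_add' _ _ := rfl
  map_mul' _ _ := rfl
  map_star' _ := rfl

theorem BddFamily.ext {x y : BddFamily F} (h : ∀ i, proj i x = proj i y) : x = y :=
  lp.ext (funext h)

/-- A pointwise bounded family of ⋆-homomorphisms, as one ⋆-homomorphism. -/
def BddFamily.lift {D : Type*} [NonUnitalRing D] [Module ℂ D] [Star D]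
    (φ : ∀ i, D →⋆ₙₐ[ℂ] F i) (h : ∀ d, ∃ C : ℝ, ∀ i, ‖φ i d‖ ≤ C) :
    D →⋆ₙₐ[ℂ] BddFamily F where
  toFun d := ⟨fun i => φ i d, by
    obtain ⟨C, hC⟩ := h d
    refine memℓp_infty ⟨C, ?_⟩
    rintro _ ⟨i, rfl⟩
    exact hC i⟩
  map_smul' c s := ext fun i => map_smul (φ i) c s
  map_zero' := ext fun i => map_zero (φ i)
  map_add' s t := ext fun i => map_add (φ i) s t
  map_mul' s t := ext fun i => map_mul (φ i) s t
  map_star' s := ext fun i => map_star (φ i) s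

end Family

section SpatialTensor

variable (A : Type u) (B : Type v)
  [NonUnitalCStarAlgebra A] [PartialOrder A] [StarOrderedRing A]
  [NonUnitalCStarAlgebra B] [PartialOrder B] [StarOrderedRing B]

variable {A B} in
/-- The tensor product `π_f ⊗ π_g` of the GNS representations of two positive functionals. -/
def gnsRep (f : A →ₚ[ℂ] ℂ) (g : B →ₚ[ℂ] ℂ) : A ⊗[ℂ] B →⋆ₙₐ[ℂ]
    (HilbertTensor f.GNS g.GNS →L[ℂ] HilbertTensor f.GNS g.GNS) :=
  HilbertTensor.rep f.gnsNonUnitalStarAlgHom g.gnsNonUnitalStarAlgHom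

variable {A B} in
theorem gnsRep_bounded (s : A ⊗[ℂ] B) : ∃ C : ℝ, ∀ (f : A →ₚ[ℂ] ℂ) (g : B →ₚ[ℂ] ℂ),
    ‖gnsRep f g s‖ ≤ C := by
  induction s with
  | zero => exact ⟨0, fun f g => by rw [map_zero, norm_zero]⟩
  | tmul a b =>
    refine ⟨‖a‖ * ‖b‖, fun f g => (HilbertTensor.norm_op_le _ _).trans ?_⟩
    gcongr
    · exact NonUnitalStarAlgHom.norm_apply_le f.gnsNonUnitalStarAlgHom a
    · exact NonUnitalStarAlgHom.norm_apply_le g.gnsNonUnitalStarAlgHom b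
  | add s s' hs hs' =>
    obtain ⟨C, hC⟩ := hs
    obtain ⟨C', hC'⟩ := hs'
    refine ⟨C + C', fun f g => ?_⟩
    rw [map_add]
    refine (norm_add_le _ _).trans ?_
    have h1 := hC f g
    have h2 := hC' f g
    gcongr

/-- The C⋆-algebra of bounded families of operators on the spaces `H_f ⊗ H_g`, indexed by the
pairs of positive functionals on `A` and on `B`. -/
abbrev BlockOp : Type (max u v) :=
  BddFamily (fun p : (A →ₚ[ℂ] ℂ) × (B →ₚ[ℂ] ℂ) =>
    (HilbertTensor p.1.GNS p.2.GNS →L[ℂ] HilbertTensor p.1.GNS p.2.GNS))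

/-- The tensor product of the universal representations of `A` and `B`, on the algebraic tensor
product. -/
def universalRep : A ⊗[ℂ] B →⋆ₙₐ[ℂ] BlockOp A B :=
  BddFamily.lift (fun p => gnsRep p.1 p.2) fun s => by
    obtain ⟨C, hC⟩ := gnsRep_bounded s
    exact ⟨C, fun p => hC p.1 p.2⟩

/-- The minimal (spatial) tensor product `A ⊗ B`: the norm closure of the image of the algebraic
tensor product under the tensor product of the universal representations. -/
def MinTensor : Type (max u v) :=
  (NonUnitalStarAlgHom.range (universalRep A B)).topologicalClosure

namespace MinTensor

instance : NonUnitalCStarAlgebra (MinTensor A B) :=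
  haveI : IsClosed ((NonUnitalStarAlgHom.range (universalRep A B)).topologicalClosure :
    Set (BlockOp A B)) := NonUnitalStarSubalgebra.isClosed_topologicalClosure _
  inferInstanceAs (NonUnitalCStarAlgebra
    (NonUnitalStarAlgHom.range (universalRep A B)).topologicalClosure)

instance : PartialOrder (MinTensor A B) := CStarAlgebra.spectralOrder _

instance : StarOrderedRing (MinTensor A B) := CStarAlgebra.spectralOrderedRing _

/-- The canonical map `A ⊙ B → A ⊗ B`. -/
def ι : A ⊗[ℂ] B →⋆ₙₐ[ℂ] MinTensor A B where
  toFun s := ⟨universalRep A B s, NonUnitalStarSubalgebra.le_topologicalClosure _ ⟨s, rfl⟩⟩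
  map_smul' c s := Subtype.ext (map_smul (universalRep A B) c s)
  map_zero' := Subtype.ext (map_zero (universalRep A B))
  map_add' s t := Subtype.ext (map_add (universalRep A B) s t)
  map_mul' s t := Subtype.ext (map_mul (universalRep A B) s t)
  map_star' s := Subtype.ext (map_star (universalRep A B) s)

theorem denseRange_ι : DenseRange (ι A B) := by
  intro x
  refine (closure_subtype (X := BlockOp A B)
    (p := (· ∈ (NonUnitalStarAlgHom.range (universalRep A B)).topologicalClosure))
    (x := x) (s := Set.range (ι A B))).2 ?_
  refine closure_mono ?_ x.2
  rintro _ ⟨s, rfl⟩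
  exact ⟨ι A B s, ⟨s, rfl⟩, rfl⟩

variable {A B} in
/-- The restriction of an element of `A ⊗ B` to the block `H_f ⊗ H_g`. -/
def block (f : A →ₚ[ℂ] ℂ) (g : B →ₚ[ℂ] ℂ) : MinTensor A B →⋆ₙₐ[ℂ]
    (HilbertTensor f.GNS g.GNS →L[ℂ] HilbertTensor f.GNS g.GNS) where
  toFun x := BddFamily.proj (f, g) x.1
  map_smul' c x := map_smul (BddFamily.proj (f, g)) c x.1
  map_zero' := map_zero (BddFamily.proj (f, g))
  map_add' x y := map_add (BddFamily.proj (f, g)) x.1 y.1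
  map_mul' x y := map_mul (BddFamily.proj (f, g)) x.1 y.1
  map_star' x := map_star (BddFamily.proj (f, g)) x.1

variable {A B} in
theorem block_ι (f : A →ₚ[ℂ] ℂ) (g : B →ₚ[ℂ] ℂ) (s : A ⊗[ℂ] B) :
    block f g (ι A B s) = gnsRep f g s := rfl

variable {A B} in
theorem ext_block {x y : MinTensor A B} (h : ∀ (f : A →ₚ[ℂ] ℂ) (g : B →ₚ[ℂ] ℂ), block f g x = block f g y) : x = y :=
  Subtype.ext (BddFamily.ext fun p => h p.1 p.2)

variable {A B} in
theorem nonneg_of_block {x : MinTensor A B} (h : ∀ (f : A →ₚ[ℂ] ℂ) (g : B →ₚ[ℂ] ℂ), 0 ≤ block f g x) : 0 ≤ x := by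
  have hx : IsSelfAdjoint x := ext_block fun f g => by
    rw [map_star]
    exact (IsSelfAdjoint.of_nonneg (h f g))
  rw [← CFC.negPart_eq_zero_iff x hx]
  refine ext_block fun f g => ?_
  rw [map_zero, CFC.negPart_def, NonUnitalStarAlgHomClass.map_cfcₙ (block f g) _ x,
    ← CFC.negPart_def, CFC.negPart_eq_zero_iff _ (IsSelfAdjoint.of_nonneg (h f g))]
  exact h f g

end MinTensor
end SpatialTensor

section Positivity

/-- A positive semidefinite form on a vector space is induced by a map to an inner product
space. -/
theorem exists_innerProductSpace_of_form {V : Type u} [AddCommGroup V] [Module ℂ V]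
    (q : V →ₗ⋆[ℂ] V →ₗ[ℂ] ℂ) (hs : ∀ x y, star (q y x) = q x y) (hq : ∀ x, 0 ≤ q x x) :
    ∃ (H : Type u) (_ : NormedAddCommGroup H) (_ : InnerProductSpace ℂ H) (κ : V →ₗ[ℂ] H),
      ∀ x y, ⟪κ x, κ y⟫_ℂ = q x y := by
  let c : PreInnerProductSpace.Core ℂ V :=
    { inner := fun x y => q x y
      conj_inner_symm := hs
      re_inner_nonneg := fun x => (Complex.le_def.1 (hq x)).1
      add_left := fun x y z => by simp
      smul_left := fun x y r => by simp }
  let : SeminormedAddCommGroup V := InnerProductSpace.Core.toSeminormedAddCommGroup (c := c)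
  let : InnerProductSpace ℂ V := InnerProductSpace.ofCore c
  exact ⟨Completion V, inferInstance, inferInstance, (Completion.toComplₗᵢ (𝕜 := ℂ)).toLinearMap,
    fun x y => Completion.inner_coe x y⟩

variable {A : Type u} {B : Type v}
  [NonUnitalCStarAlgebra A] [PartialOrder A] [StarOrderedRing A]
  [NonUnitalCStarAlgebra B] [PartialOrder B] [StarOrderedRing B]

/-- The functional `f ⊗ g` on the algebraic tensor product. -/
def tensorFunctional (f : A →ₚ[ℂ] ℂ) (g : B →ₚ[ℂ] ℂ) : A ⊗[ℂ] B →ₗ[ℂ] ℂ :=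
  TensorProduct.lift ((LinearMap.mul ℂ ℂ).compl₁₂ f.toLinearMap g.toLinearMap)

theorem tensorFunctional_tmul (f : A →ₚ[ℂ] ℂ) (g : B →ₚ[ℂ] ℂ) (a : A) (b : B) :
    tensorFunctional f g (a ⊗ₜ b) = f a * g b := rfl

/-- The dense image of `A ⊙ B` in the tensor product of two GNS spaces. -/
def gnsVector (f : A →ₚ[ℂ] ℂ) (g : B →ₚ[ℂ] ℂ) : A ⊗[ℂ] B →ₗ[ℂ] HilbertTensor f.GNS g.GNS :=
  HilbertTensor.incl.toLinearMap ∘ₗ TensorProduct.map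
    ((Completion.toComplₗᵢ (𝕜 := ℂ) (E := f.PreGNS)).toLinearMap ∘ₗ f.toPreGNS.toLinearMap)
    ((Completion.toComplₗᵢ (𝕜 := ℂ) (E := g.PreGNS)).toLinearMap ∘ₗ g.toPreGNS.toLinearMap)

theorem gnsVector_tmul (f : A →ₚ[ℂ] ℂ) (g : B →ₚ[ℂ] ℂ) (a : A) (b : B) :
    gnsVector f g (a ⊗ₜ b) =
      HilbertTensor.incl ((f.toPreGNS a : f.GNS) ⊗ₜ[ℂ] (g.toPreGNS b : g.GNS)) := rfl

theorem inner_gnsVector (f : A →ₚ[ℂ] ℂ) (g : B →ₚ[ℂ] ℂ) (t s t' : A ⊗[ℂ] B) :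
    ⟪gnsVector f g t, gnsRep f g s (gnsVector f g t')⟫_ℂ =
      tensorFunctional f g (star t * (s * t')) := by
  induction t with
  | zero => rw [star_zero, zero_mul, map_zero, map_zero, inner_zero_left]
  | add t₁ t₂ h₁ h₂ => rw [map_add, inner_add_left, h₁, h₂, star_add, add_mul, map_add]
  | tmul a b =>
    induction t' with
    | zero => rw [map_zero, map_zero, inner_zero_right, mul_zero, mul_zero, map_zero]
    | add t₁ t₂ h₁ h₂ =>
      rw [map_add, map_add, inner_add_right, h₁, h₂, mul_add, mul_add, map_add]
    | tmul a' b' =>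
      induction s with
      | zero => rw [map_zero, zero_mul, mul_zero, map_zero]; simp
      | add s₁ s₂ h₁ h₂ =>
        rw [map_add, add_mul, mul_add, map_add, ← h₁, ← h₂, add_apply, inner_add_right]
      | tmul c d =>
        have h : gnsRep f g (c ⊗ₜ d) (gnsVector f g (a' ⊗ₜ b')) =
            gnsVector f g ((c * a') ⊗ₜ (d * b')) := by
          rw [gnsVector_tmul, gnsVector_tmul, gnsRep, HilbertTensor.rep_tmul,
            HilbertTensor.op_incl_tmul, PositiveLinearMap.gnsNonUnitalStarAlgHom_apply_coe,
            PositiveLinearMap.gnsNonUnitalStarAlgHom_apply_coe]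
          rfl
        rw [h, gnsVector_tmul, gnsVector_tmul, HilbertTensor.inner_incl_tmul,
          Completion.inner_coe, Completion.inner_coe, PositiveLinearMap.preGNS_inner_def,
          PositiveLinearMap.preGNS_inner_def, TensorProduct.star_tmul,
          Algebra.TensorProduct.tmul_mul_tmul, Algebra.TensorProduct.tmul_mul_tmul,
          tensorFunctional_tmul]
        rfl

theorem denseRange_gnsVector (f : A →ₚ[ℂ] ℂ) (g : B →ₚ[ℂ] ℂ) : DenseRange (gnsVector f g) := by
  let W : Submodule ℂ (HilbertTensor f.GNS g.GNS) :=
    (LinearMap.range (gnsVector f g)).topologicalClosure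
  have hcl : IsClosed (W : Set (HilbertTensor f.GNS g.GNS)) :=
    Submodule.isClosed_topologicalClosure _
  suffices h : ∀ ξ, ξ ∈ W from fun ξ => h ξ
  have hcont : Continuous fun p : f.GNS × g.GNS => HilbertTensor.incl (p.1 ⊗ₜ[ℂ] p.2) :=
    HilbertTensor.incl.continuous.comp TensorProduct.continuous_tmul
  intro ξ
  induction ξ using HilbertTensor.induction_on with
  | hp => exact hcl
  | h ξ =>
    induction ξ with
    | zero => rw [map_zero]; exact W.zero_mem
    | add x y hx hy => rw [map_add]; exact W.add_mem hx hy
    | tmul x y =>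
      induction x, y using Completion.induction_on₂ with
      | hp => exact hcl.preimage hcont
      | ih a b =>
        exact Submodule.le_topologicalClosure _ ⟨f.ofPreGNS a ⊗ₜ g.ofPreGNS b, rfl⟩

/-- Positivity in the minimal tensor product, tested on product functionals. -/
theorem MinTensor.ι_nonneg {s : A ⊗[ℂ] B} (hs : star s = s)
    (h : ∀ (f : A →ₚ[ℂ] ℂ) (g : B →ₚ[ℂ] ℂ) (t : A ⊗[ℂ] B),
      0 ≤ tensorFunctional f g (star t * (s * t))) : 0 ≤ ι A B s := by
  refine nonneg_of_block fun f g => ?_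
  rw [block_ι, ContinuousLinearMap.nonneg_iff_isPositive, ContinuousLinearMap.isPositive_def']
  refine ⟨?_, fun ξ => ?_⟩
  · rw [IsSelfAdjoint, ← map_star, hs]
  · rw [ContinuousLinearMap.reApplyInnerSelf_apply]
    induction ξ using (denseRange_gnsVector f g).induction_on with
    | hp => exact isClosed_le (by fun_prop) (by fun_prop)
    | ih t =>
      rw [← inner_re_symm, inner_gnsVector]
      exact (Complex.le_def.1 (h f g t)).1

end Positivity

section HilbertModule

universe w w'

variable {A : Type u} {M : Type w} [NonUnitalCStarAlgebra A] [PartialOrder A] [StarOrderedRing A]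
  [NormedAddCommGroup M] [NormedSpace ℂ M] [SMul A M] [CStarModule A M]

namespace HilbertModule

variable (A) in
theorem ext_inner {x y : M} (h : ∀ z : M, inner A z x = inner A z y) : x = y := by
  have h0 : inner A (x - y) (x - y) = 0 := by
    rw [CStarModule.inner_sub_right, h, sub_self]
  exact sub_eq_zero.1 (CStarModule.inner_self.1 h0)

/-- The action of `A` on a Hilbert `A`-module as a bilinear map. -/
def act : A →ₗ[ℂ] M →ₗ[ℂ] M :=
  LinearMap.mk₂ ℂ (fun a x => a • x)
    (fun a b x => ext_inner A fun z => by simp [add_mul])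
    (fun c a x => ext_inner A fun z => by simp [smul_mul_assoc])
    (fun a x y => ext_inner A fun z => by simp [mul_add])
    (fun c a x => ext_inner A fun z => by simp [mul_smul_comm])

theorem norm_smul_le (a : A) (x : M) : ‖a • x‖ ≤ ‖a‖ * ‖x‖ := by
  rw [← sq_le_sq₀ (norm_nonneg _) (by positivity), CStarModule.norm_sq_eq A, mul_pow,
    CStarModule.norm_sq_eq A (x := x), CStarModule.inner_op_smul_right, CStarModule.inner_op_smul_left]
  calc ‖a * (inner A x x * star a)‖ ≤ ‖a‖ * (‖inner A x x‖ * ‖star a‖) :=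
        (norm_mul_le _ _).trans (by gcongr; exact norm_mul_le _ _)
    _ = ‖a‖ ^ 2 * ‖inner A x x‖ := by rw [norm_star]; ring

end HilbertModule

end HilbertModule

section ExternalTensor

universe w w'

/-- The algebraic tensor product `M ⊙ N` of a Hilbert `A`-module and a Hilbert `B`-module. -/
def AlgTensor (_A : Type u) (_B : Type v) (M : Type w) (N : Type w')
    [AddCommGroup M] [Module ℂ M] [AddCommGroup N] [Module ℂ N] : Type (max w w') :=
  M ⊗[ℂ] N

variable (A : Type u) (B : Type v) (M : Type w) (N : Type w')
  [NonUnitalCStarAlgebra A] [PartialOrder A] [StarOrderedRing A]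
  [NonUnitalCStarAlgebra B] [PartialOrder B] [StarOrderedRing B]
  [NormedAddCommGroup M] [NormedSpace ℂ M] [SMul A M] [CStarModule A M]
  [NormedAddCommGroup N] [NormedSpace ℂ N] [SMul B N] [CStarModule B N]

namespace AlgTensor

instance : AddCommGroup (AlgTensor A B M N) := inferInstanceAs (AddCommGroup (M ⊗[ℂ] N))
instance : Module ℂ (AlgTensor A B M N) := inferInstanceAs (Module ℂ (M ⊗[ℂ] N))

/-- The `A ⊙ B`-valued form with `⟨x ⊗ y, x' ⊗ y'⟩ = ⟨x, x'⟩ ⊗ ⟨y, y'⟩`. -/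
def form : AlgTensor A B M N →ₗ⋆[ℂ] AlgTensor A B M N →ₗ[ℂ] A ⊗[ℂ] B :=
  TensorProduct.map₂ (CStarModule.innerₛₗ (A := A) (E := M))
    (CStarModule.innerₛₗ (A := B) (E := N))

/-- The action of `A ⊙ B` with `(a ⊗ b) • (x ⊗ y) = (a • x) ⊗ (b • y)`. -/
def act : A ⊗[ℂ] B →ₗ[ℂ] AlgTensor A B M N →ₗ[ℂ] AlgTensor A B M N :=
  TensorProduct.map₂ (HilbertModule.act (A := A) (M := M)) (HilbertModule.act (A := B) (M := N))

variable {A B M N}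

/-- The elementary tensor `x ⊗ y`. -/
def tmul (x : M) (y : N) : AlgTensor A B M N := x ⊗ₜ[ℂ] y

theorem form_tmul (x x' : M) (y y' : N) :
    form A B M N (tmul x y) (tmul x' y') = inner A x x' ⊗ₜ[ℂ] inner B y y' := rfl

theorem act_tmul (a : A) (b : B) (x : M) (y : N) :
    act A B M N (a ⊗ₜ b) (tmul x y) = tmul (a • x) (b • y) := rfl

@[elab_as_elim]
theorem induction_on {p : AlgTensor A B M N → Prop} (z : AlgTensor A B M N) (zero : p 0)
    (tmul : ∀ x y, p (tmul x y)) (add : ∀ z w, p z → p w → p (z + w)) : p z :=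
  TensorProduct.induction_on z zero tmul add

theorem star_form (z w : AlgTensor A B M N) :
    star (form A B M N z w) = form A B M N w z := by
  induction z using induction_on with
  | zero => simp
  | add z z' h h' => simp only [map_add, LinearMap.add_apply, star_add, h, h']
  | tmul x y =>
    induction w using induction_on with
    | zero => simp
    | add w w' h h' => simp only [map_add, LinearMap.add_apply, star_add, h, h']
    | tmul x' y' =>
      rw [form_tmul, form_tmul, TensorProduct.star_tmul, CStarModule.star_inner,
        CStarModule.star_inner]

theorem form_act_right (d : A ⊗[ℂ] B) (z w : AlgTensor A B M N) :
    form A B M N z (act A B M N d w) = d * form A B M N z w := by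
  induction z using induction_on with
  | zero => simp
  | add z z' h h' => simp only [map_add, LinearMap.add_apply, mul_add, h, h']
  | tmul x y =>
    induction w using induction_on with
    | zero => simp
    | add w w' h h' => simp only [map_add, mul_add, h, h']
    | tmul x' y' =>
      induction d with
      | zero => simp
      | add d d' h h' => simp only [map_add, LinearMap.add_apply, add_mul, h, h']
      | tmul a b =>
        rw [act_tmul, form_tmul, form_tmul, Algebra.TensorProduct.tmul_mul_tmul,
          CStarModule.inner_op_smul_right, CStarModule.inner_op_smul_right]

theorem form_act_left (d : A ⊗[ℂ] B) (z w : AlgTensor A B M N) :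
    form A B M N (act A B M N d z) w = form A B M N z w * star d := by
  rw [← star_form, form_act_right, star_mul, star_form]

theorem tensorFunctional_form_nonneg (f : A →ₚ[ℂ] ℂ) (g : B →ₚ[ℂ] ℂ) (z : AlgTensor A B M N) :
    0 ≤ tensorFunctional f g (form A B M N z z) := by
  obtain ⟨H, _, _, κ, hκ⟩ := exists_innerProductSpace_of_form
    ((CStarModule.innerₛₗ (A := A) (E := M)).compr₂ₛₗ f.toLinearMap)
    (fun x y => by
      change star (f (inner A y x)) = f (inner A x y)
      rw [← map_star, CStarModule.star_inner])
    (fun x => f.map_nonneg CStarModule.inner_self_nonneg)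
  obtain ⟨K, _, _, μ, hμ⟩ := exists_innerProductSpace_of_form
    ((CStarModule.innerₛₗ (A := B) (E := N)).compr₂ₛₗ g.toLinearMap)
    (fun x y => by
      change star (g (inner B y x)) = g (inner B x y)
      rw [← map_star, CStarModule.star_inner])
    (fun x => g.map_nonneg CStarModule.inner_self_nonneg)
  let T : AlgTensor A B M N →ₗ[ℂ] H ⊗[ℂ] K := TensorProduct.map κ μ
  have h : ∀ z w, tensorFunctional f g (form A B M N z w) = ⟪T z, T w⟫_ℂ := by
    intro z w
    induction z using induction_on with
    | zero => simp
    | add z z' h h' => simp only [map_add, LinearMap.add_apply, _root_.inner_add_left, h, h']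
    | tmul x y =>
      induction w using induction_on with
      | zero => simp
      | add w w' h h' => simp only [map_add, _root_.inner_add_right, h, h']
      | tmul x' y' =>
        rw [form_tmul, tensorFunctional_tmul]
        change _ = ⟪κ x ⊗ₜ[ℂ] μ y, κ x' ⊗ₜ[ℂ] μ y'⟫_ℂ
        rw [TensorProduct.inner_tmul, hκ, hμ]
        rfl
  rw [h]
  exact RCLike.nonneg_iff.2 ⟨_root_.inner_self_nonneg (𝕜 := ℂ) (x := T z),
    _root_.inner_self_im (𝕜 := ℂ) (T z)⟩

/-- The `A ⊗ B`-valued semi-inner product on `M ⊙ N`. -/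
instance : Inner (MinTensor A B) (AlgTensor A B M N) where
  inner z w := MinTensor.ι A B (form A B M N z w)

theorem inner_def (z w : AlgTensor A B M N) :
    inner (MinTensor A B) z w = MinTensor.ι A B (form A B M N z w) := rfl

theorem inner_add_left (z z' w : AlgTensor A B M N) :
    inner (MinTensor A B) (z + z') w =
      inner (MinTensor A B) z w + inner (MinTensor A B) z' w := by
  simp only [inner_def, map_add, LinearMap.add_apply]

theorem inner_add_right (z w w' : AlgTensor A B M N) :
    inner (MinTensor A B) z (w + w') =
      inner (MinTensor A B) z w + inner (MinTensor A B) z w' := by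
  simp only [inner_def, map_add]

theorem inner_smul_left (c : ℂ) (z w : AlgTensor A B M N) :
    inner (MinTensor A B) (c • z) w = star c • inner (MinTensor A B) z w := by
  rw [inner_def, LinearMap.map_smulₛₗ₂, map_smul]
  rfl

theorem inner_smul_right (c : ℂ) (z w : AlgTensor A B M N) :
    inner (MinTensor A B) z (c • w) = c • inner (MinTensor A B) z w := by
  rw [inner_def, map_smul, map_smul, inner_def]

theorem inner_act_right (d : A ⊗[ℂ] B) (z w : AlgTensor A B M N) :
    inner (MinTensor A B) z (act A B M N d w) =
      MinTensor.ι A B d * inner (MinTensor A B) z w := by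
  rw [inner_def, form_act_right, map_mul, inner_def]

theorem inner_act_left (d : A ⊗[ℂ] B) (z w : AlgTensor A B M N) :
    inner (MinTensor A B) (act A B M N d z) w =
      inner (MinTensor A B) z w * star (MinTensor.ι A B d) := by
  rw [inner_def, form_act_left, map_mul, map_star, inner_def]

theorem inner_self_nonneg (z : AlgTensor A B M N) : 0 ≤ inner (MinTensor A B) z z := by
  refine MinTensor.ι_nonneg (star_form z z) fun f g t => ?_
  have h := tensorFunctional_form_nonneg f g (act A B M N (star t) z)
  rwa [form_act_right, form_act_left, star_star] at h

theorem star_inner (z w : AlgTensor A B M N) :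
    star (inner (MinTensor A B) z w) = inner (MinTensor A B) w z := by
  rw [inner_def, ← map_star, star_form]; rfl

/-- The seminorm `‖z‖ = ‖⟨z, z⟩‖ ^ (1 / 2)` on `M ⊙ N`. -/
instance : Norm (AlgTensor A B M N) where
  norm z := √‖inner (MinTensor A B) z z‖

theorem norm_def (z : AlgTensor A B M N) : ‖z‖ = √‖inner (MinTensor A B) z z‖ := rfl

theorem norm_sq (z : AlgTensor A B M N) : ‖z‖ ^ 2 = ‖inner (MinTensor A B) z z‖ :=
  Real.sq_sqrt (norm_nonneg _)

theorem norm_inner_le (z w : AlgTensor A B M N) :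
    ‖inner (MinTensor A B) z w‖ ≤ ‖z‖ * ‖w‖ := by
  have key : ∀ r : ℝ, ‖z‖ ^ 2 ≤ r → 0 < r →
      ‖inner (MinTensor A B) z w‖ ^ 2 ≤ r * ‖w‖ ^ 2 := by
    intro r hr hr0
    set d := form A B M N z w with hd
    set c := inner (MinTensor A B) z w with hc
    have hcd : MinTensor.ι A B d = c := rfl
    have hwz : inner (MinTensor A B) w z = star c := (star_inner z w).symm
    -- expand `0 ≤ ⟨d z - r w, d z - r w⟩`
    have h0 := inner_self_nonneg (act A B M N d z + (-r : ℂ) • w)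
    have h1 : inner (MinTensor A B) (act A B M N d z + (-r : ℂ) • w)
        (act A B M N d z + (-r : ℂ) • w) =
        c * inner (MinTensor A B) z z * star c - (2 * r) • (c * star c)
          + (r * r) • inner (MinTensor A B) w w := by
      have e : star (-r : ℂ) = -r := by simp
      simp only [inner_add_left, inner_add_right, inner_smul_left, inner_smul_right,
        inner_act_left, inner_act_right, hcd, hwz, ← hc, e]
      simp only [neg_smul, smul_neg, neg_neg, Complex.coe_smul, mul_smul, two_smul, mul_assoc,
        smul_add, mul_add, mul_neg, mul_smul_comm]
      abel
    have h2 : c * inner (MinTensor A B) z z * star c ≤ r • (c * star c) := by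
      refine (CStarAlgebra.star_right_conjugate_le_norm_smul
        (hb := star_inner z z)).trans ?_
      rw [← norm_sq]
      exact smul_le_smul_of_nonneg_right hr (mul_star_self_nonneg c)
    have h3 : r • (c * star c) ≤ (r * r) • inner (MinTensor A B) w w := by
      rw [h1] at h0
      have h4 : 0 ≤ r • (c * star c) - (2 * r) • (c * star c)
          + (r * r) • inner (MinTensor A B) w w := h0.trans (by gcongr)
      have h5 : r • (c * star c) - (2 * r) • (c * star c)
          + (r * r) • inner (MinTensor A B) w w =
          (r * r) • inner (MinTensor A B) w w - r • (c * star c) := by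
        rw [two_mul, add_smul]; abel
      rw [h5] at h4
      exact sub_nonneg.1 h4
    have h6 : c * star c ≤ r • inner (MinTensor A B) w w := by
      rw [mul_smul] at h3
      exact (smul_le_smul_iff_of_pos_left hr0).1 h3
    have h7 := CStarAlgebra.norm_le_norm_of_nonneg_of_le (mul_star_self_nonneg c) h6
    rw [CStarRing.norm_self_mul_star, norm_smul, Real.norm_of_nonneg hr0.le, ← norm_sq] at h7
    rw [sq]
    exact h7
  have hz : 0 ≤ ‖z‖ := Real.sqrt_nonneg _
  have hw : 0 ≤ ‖w‖ := Real.sqrt_nonneg _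
  have key2 : ‖inner (MinTensor A B) z w‖ ^ 2 ≤ ‖z‖ ^ 2 * ‖w‖ ^ 2 := by
    refine ge_of_tendsto (x := nhdsWithin (‖z‖ ^ 2) (Set.Ioi (‖z‖ ^ 2)))
      (f := fun r : ℝ => r * ‖w‖ ^ 2) ?_ ?_
    · exact ((continuous_id.mul continuous_const).tendsto _).mono_left nhdsWithin_le_nhds
    · filter_upwards [self_mem_nhdsWithin] with r hr
      exact key r (le_of_lt hr) (lt_of_le_of_lt (sq_nonneg _) hr)
  rw [← mul_pow] at key2
  exact (sq_le_sq₀ (norm_nonneg _) (mul_nonneg hz hw)).1 key2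

theorem core : SeminormedSpace.Core ℂ (AlgTensor A B M N) where
  norm_nonneg z := Real.sqrt_nonneg _
  norm_smul c z := by
    have h : inner (MinTensor A B) (c • z) (c • z) =
        (star c * c) • inner (MinTensor A B) z z := by
      rw [inner_smul_left, inner_smul_right, mul_smul]
    rw [norm_def, norm_def, h, norm_smul, CStarRing.norm_star_mul_self,
      Real.sqrt_mul (by positivity), Real.sqrt_mul_self (norm_nonneg c)]
  norm_triangle z w := by
    have hz : 0 ≤ ‖z‖ := Real.sqrt_nonneg _
    have hw : 0 ≤ ‖w‖ := Real.sqrt_nonneg _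
    refine (sq_le_sq₀ (Real.sqrt_nonneg _) (add_nonneg hz hw)).1 ?_
    have h : inner (MinTensor A B) (z + w) (z + w) = inner (MinTensor A B) z z +
        inner (MinTensor A B) z w + (inner (MinTensor A B) w z + inner (MinTensor A B) w w) := by
      rw [inner_add_left, inner_add_right, inner_add_right]
    calc ‖z + w‖ ^ 2 = ‖inner (MinTensor A B) (z + w) (z + w)‖ := norm_sq _
      _ ≤ ‖z‖ ^ 2 + ‖z‖ * ‖w‖ + (‖w‖ * ‖z‖ + ‖w‖ ^ 2) := by
          rw [h, norm_sq, norm_sq]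
          refine (norm_add_le _ _).trans (add_le_add ((norm_add_le _ _).trans ?_)
            ((norm_add_le _ _).trans ?_))
          · exact add_le_add le_rfl (norm_inner_le z w)
          · exact add_le_add (norm_inner_le w z) le_rfl
      _ = (‖z‖ + ‖w‖) ^ 2 := by ring

instance : SeminormedAddCommGroup (AlgTensor A B M N) := SeminormedAddCommGroup.ofCore core

instance : NormedSpace ℂ (AlgTensor A B M N) where
  norm_smul_le c z := (core.norm_smul c z).le

theorem norm_act_le (d : A ⊗[ℂ] B) (z : AlgTensor A B M N) :
    ‖act A B M N d z‖ ≤ ‖MinTensor.ι A B d‖ * ‖z‖ := by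
  rw [← sq_le_sq₀ (norm_nonneg _) (by positivity), norm_sq, mul_pow, norm_sq, inner_act_right,
    inner_act_left]
  refine (norm_mul_le _ _).trans ?_
  rw [sq, mul_assoc]
  gcongr
  refine (norm_mul_le _ _).trans ?_
  rw [norm_star, mul_comm]

end AlgTensor


/-- The external tensor product `M ⊗ N` of Hilbert modules: the completion of the algebraic tensor
product in the norm of its `A ⊗ B`-valued inner product. -/
def ExternalTensor : Type (max w w') := Completion (AlgTensor A B M N)

namespace ExternalTensor

instance : NormedAddCommGroup (ExternalTensor A B M N) :=
  inferInstanceAs (NormedAddCommGroup (Completion (AlgTensor A B M N)))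
instance : NormedSpace ℂ (ExternalTensor A B M N) :=
  inferInstanceAs (NormedSpace ℂ (Completion (AlgTensor A B M N)))
instance : CompleteSpace (ExternalTensor A B M N) :=
  inferInstanceAs (CompleteSpace (Completion (AlgTensor A B M N)))

/-- The canonical map `M ⊙ N → M ⊗ N`. -/
def incl : AlgTensor A B M N →ₗᵢ[ℂ] ExternalTensor A B M N := Completion.toComplₗᵢ

variable {A B M N}

@[elab_as_elim]
theorem induction_on {p : ExternalTensor A B M N → Prop} (x : ExternalTensor A B M N)
    (hp : IsClosed {x | p x}) (h : ∀ z, p (incl A B M N z)) : p x :=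
  Completion.induction_on x hp h

/-- The extension of a continuous map on `M ⊙ N` to `M ⊗ N`. -/
def extend {σ : ℂ →+* ℂ} {F : Type*} [NormedAddCommGroup F] [NormedSpace ℂ F] [CompleteSpace F]
    (S : AlgTensor A B M N →SL[σ] F) : ExternalTensor A B M N →SL[σ] F :=
  ContinuousLinearMap.fromCompletion S

@[simp]
theorem extend_incl {σ : ℂ →+* ℂ} {F : Type*} [NormedAddCommGroup F] [NormedSpace ℂ F]
    [CompleteSpace F] (S : AlgTensor A B M N →SL[σ] F) (z : AlgTensor A B M N) :
    extend S (incl A B M N z) = S z :=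
  ContinuousLinearMap.fromCompletion_apply_coe S z

theorem ext_incl {σ : ℂ →+* ℂ} {F : Type*} [NormedAddCommGroup F] [NormedSpace ℂ F]
    {S T : ExternalTensor A B M N →SL[σ] F}
    (h : ∀ z, S (incl A B M N z) = T (incl A B M N z)) : S = T := by
  ext x
  induction x using induction_on with
  | hp => exact isClosed_eq S.continuous T.continuous
  | h z => exact h z

variable (A B M N)

/-- The functional `⟨z, ·⟩` on `M ⊗ N`, for `z` in `M ⊙ N`. -/
def innerLeft (z : AlgTensor A B M N) : ExternalTensor A B M N →L[ℂ] MinTensor A B :=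
  extend <| LinearMap.mkContinuous
    ((MinTensor.ι A B : A ⊗[ℂ] B →ₗ[ℂ] MinTensor A B) ∘ₗ AlgTensor.form A B M N z) ‖z‖
    (AlgTensor.norm_inner_le z)

theorem innerLeft_incl (z w : AlgTensor A B M N) :
    innerLeft A B M N z (incl A B M N w) = inner (MinTensor A B) z w :=
  extend_incl (σ := RingHom.id ℂ) _ w

/-- The inner product on `M ⊗ N`, the continuous extension of the one on `M ⊙ N`. -/
def innerExt : ExternalTensor A B M N →L⋆[ℂ] ExternalTensor A B M N →L[ℂ] MinTensor A B :=
  extend <| LinearMap.mkContinuous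
    { toFun := innerLeft A B M N
      map_add' := fun z z' => ext_incl fun w => by
        rw [add_apply, innerLeft_incl, innerLeft_incl, innerLeft_incl, AlgTensor.inner_add_left]
      map_smul' := fun c z => ext_incl fun w => by
        rw [smul_apply, innerLeft_incl, innerLeft_incl, AlgTensor.inner_smul_left]
        rfl } 1 fun z => by
    refine ContinuousLinearMap.opNorm_le_bound _ (by positivity) fun x => ?_
    induction x using induction_on with
    | hp => exact isClosed_le (by fun_prop) (by fun_prop)
    | h w =>
      rw [one_mul, LinearIsometry.norm_map]
      exact (innerLeft_incl A B M N z w).symm ▸ AlgTensor.norm_inner_le z w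

/-- The action of `A ⊙ B` on `M ⊗ N`. -/
def actAlg : A ⊗[ℂ] B →ₗ[ℂ] ExternalTensor A B M N →L[ℂ] ExternalTensor A B M N where
  toFun d := extend <| (incl A B M N).toContinuousLinearMap ∘L
    (AlgTensor.act A B M N d).mkContinuous ‖MinTensor.ι A B d‖ (AlgTensor.norm_act_le d)
  map_add' d d' := ext_incl fun z => by simp
  map_smul' c d := ext_incl fun z => by simp

theorem actAlg_incl (d : A ⊗[ℂ] B) (z : AlgTensor A B M N) :
    actAlg A B M N d (incl A B M N z) = incl A B M N (AlgTensor.act A B M N d z) :=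
  extend_incl (σ := RingHom.id ℂ) _ z

theorem norm_actAlg_le (d : A ⊗[ℂ] B) : ‖actAlg A B M N d‖ ≤ 1 * ‖MinTensor.ι A B d‖ := by
  rw [one_mul]
  refine ContinuousLinearMap.opNorm_le_bound _ (norm_nonneg _) fun x => ?_
  induction x using induction_on with
  | hp => exact isClosed_le (by fun_prop) (by fun_prop)
  | h w =>
    rw [actAlg_incl, LinearIsometry.norm_map, LinearIsometry.norm_map]
    exact AlgTensor.norm_act_le d w

/-- The action of `A ⊗ B` on `M ⊗ N`, the continuous extension of the action of `A ⊙ B`. -/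
def actExt : MinTensor A B →L[ℂ] ExternalTensor A B M N →L[ℂ] ExternalTensor A B M N :=
  (actAlg A B M N).extendOfNorm (MinTensor.ι A B : A ⊗[ℂ] B →ₗ[ℂ] MinTensor A B)

instance : Inner (MinTensor A B) (ExternalTensor A B M N) where
  inner x y := innerExt A B M N x y

instance : SMul (MinTensor A B) (ExternalTensor A B M N) where
  smul c x := actExt A B M N c x

variable {A B M N}

theorem inner_def (x y : ExternalTensor A B M N) :
    inner (MinTensor A B) x y = innerExt A B M N x y := rfl

theorem smul_def (c : MinTensor A B) (x : ExternalTensor A B M N) :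
    c • x = actExt A B M N c x := rfl

theorem inner_incl (z w : AlgTensor A B M N) :
    inner (MinTensor A B) (incl A B M N z) (incl A B M N w) = inner (MinTensor A B) z w := by
  rw [inner_def, innerExt, extend_incl]
  exact innerLeft_incl A B M N z w

theorem smul_incl (d : A ⊗[ℂ] B) (z : AlgTensor A B M N) :
    MinTensor.ι A B d • incl A B M N z = incl A B M N (AlgTensor.act A B M N d z) := by
  have h : actExt A B M N (MinTensor.ι A B d) = actAlg A B M N d :=
    LinearMap.extendOfNorm_eq
      (e := (MinTensor.ι A B : A ⊗[ℂ] B →ₗ[ℂ] MinTensor A B)) (MinTensor.denseRange_ι A B)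
      ⟨1, norm_actAlg_le A B M N⟩ d
  rw [smul_def, h, actAlg_incl]

/-- `M ⊗ N` is a Hilbert module over `A ⊗ B`. -/
instance : CStarModule (MinTensor A B) (ExternalTensor A B M N) :=
  have hn : ∀ x : ExternalTensor A B M N, ‖x‖ = √‖inner (MinTensor A B) x x‖ := fun x => by
    induction x using induction_on with
    | hp =>
      simp only [inner_def]
      exact isClosed_eq (by fun_prop) (by fun_prop)
    | h z => rw [inner_incl, LinearIsometry.norm_map]; rfl
  { inner_add_right := by intros; simp only [inner_def, map_add]
    inner_self_nonneg := by
      intro x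
      induction x using induction_on with
      | hp =>
        simp only [inner_def]
        exact isClosed_le (by fun_prop) (by fun_prop)
      | h z => rw [inner_incl]; exact AlgTensor.inner_self_nonneg z
    inner_self := by
      intro x
      rw [← norm_eq_zero (a := x), hn, Real.sqrt_eq_zero (norm_nonneg _), norm_eq_zero]
    inner_op_smul_right := by
      intro c x y
      induction x using induction_on with
      | hp =>
        simp only [inner_def]
        exact isClosed_eq (by fun_prop) (by fun_prop)
      | h z =>
        induction y using induction_on with
        | hp =>
          simp only [inner_def, smul_def]
          exact isClosed_eq (by fun_prop) (by fun_prop)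
        | h w =>
          induction c using (MinTensor.denseRange_ι A B).induction_on with
          | hp =>
            simp only [inner_def, smul_def]
            exact isClosed_eq (by fun_prop) (by fun_prop)
          | ih d => rw [smul_incl, inner_incl, inner_incl, AlgTensor.inner_act_right]
    inner_smul_right_complex := by intros; simp only [inner_def, map_smul]
    star_inner := fun x y => by
      induction x using induction_on with
      | hp =>
        simp only [inner_def]
        exact isClosed_eq (by fun_prop) (by fun_prop)
      | h z =>
        induction y using induction_on with
        | hp =>
          simp only [inner_def]
          exact isClosed_eq (by fun_prop) (by fun_prop)
        | h w => rw [inner_incl, inner_incl, AlgTensor.star_inner]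
    norm_eq_sqrt_norm_inner_self := hn }

variable (A B) in
/-- The elementary tensor `x ⊗ y` in `M ⊗ N`. -/
def tmul (x : M) (y : N) : ExternalTensor A B M N := incl A B M N (AlgTensor.tmul x y)

theorem inner_tmul (x x' : M) (y y' : N) :
    inner (MinTensor A B) (tmul A B x y) (tmul A B x' y') =
      MinTensor.ι A B (inner A x x' ⊗ₜ inner B y y') :=
  inner_incl _ _

theorem smul_tmul (a : A) (b : B) (x : M) (y : N) :
    MinTensor.ι A B (a ⊗ₜ b) • tmul A B x y = tmul A B (a • x) (b • y) :=
  smul_incl _ _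

end ExternalTensor

end ExternalTensor

section CompactContainment

universe w

namespace HilbertModule

variable (A : Type u) {E : Type w} [NonUnitalCStarAlgebra A] [PartialOrder A] [StarOrderedRing A]
  [NormedAddCommGroup E] [NormedSpace ℂ E] [SMul A E] [CStarModule A E]

/-- The operator `z ↦ x ⟨y, z⟩`. (In `CStarModule` the action of `A` is written on the left,
`⟨x, a • y⟩ = a * ⟨x, y⟩`.) -/
def rankOne (x y : E) : E →L[ℂ] E :=
  LinearMap.mkContinuous
    ((act (A := A) (M := E)).flip x ∘ₗ CStarModule.innerₛₗ (A := A) (E := E) y) (‖y‖ * ‖x‖)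
    fun z => by
      change ‖inner A y z • x‖ ≤ _
      refine (norm_smul_le _ _).trans ?_
      rw [mul_right_comm]
      gcongr
      exact CStarModule.norm_inner_le E

theorem rankOne_apply (x y z : E) : rankOne A x y z = inner A y z • x := rfl

/-- The compact endomorphisms of a Hilbert `A`-module: the norm closure of the linear span of the
operators `z ↦ x ⟨y, z⟩`. -/
def IsCompactEndomorphism (b : E →L[ℂ] E) : Prop :=
  b ∈ closure (Submodule.span ℂ {T | ∃ x y : E, T = rankOne A x y} : Set (E →L[ℂ] E))

/-- Self-adjointness with respect to the `A`-valued inner product. -/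
def IsSelfAdjointEndomorphism (b : E →L[ℂ] E) : Prop :=
  ∀ x y : E, inner A (b x) y = inner A x (b y)

/-- `X` is a closed `A`-submodule of `E`, hence a Hilbert `A`-module itself. -/
structure IsHilbertSubmodule (X : Submodule ℂ E) : Prop where
  isClosed : IsClosed (X : Set E)
  smul_mem : ∀ (a : A), ∀ x ∈ X, a • x ∈ X

/-- `X` is countably generated: for some countable `s ⊆ X`, the linear span of the elements
`a • x` with `a` in `A` and `x` in `s` is dense in `X`. -/
def IsCountablyGenerated (X : Submodule ℂ E) : Prop :=
  ∃ s : Set E, s.Countable ∧ s ⊆ X ∧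
    (X : Set E) ⊆ closure (Submodule.span ℂ {z | ∃ a : A, ∃ x ∈ s, z = a • x} : Set E)

/-- `X ⊂⊂ E` for a closed submodule `X` of a Hilbert `A`-module `E`, both countably generated:
some compact self-adjoint endomorphism of `E` acts as the identity on `X`. -/
def IsCompactlyContained (X : Submodule ℂ E) : Prop :=
  IsHilbertSubmodule A X ∧ IsCountablyGenerated A X ∧ IsCountablyGenerated A (⊤ : Submodule ℂ E) ∧
    ∃ b : E →L[ℂ] E, IsCompactEndomorphism A b ∧ IsSelfAdjointEndomorphism A b ∧
      ∀ x ∈ X, b x = x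

/-- The Hilbert `A`-module `E` is a compact element: `E ⊂⊂ E`. -/
def IsCompactElement (A : Type u) (E : Type w) [NonUnitalCStarAlgebra A] [PartialOrder A]
    [StarOrderedRing A] [NormedAddCommGroup E] [NormedSpace ℂ E] [SMul A E] [CStarModule A E] :
    Prop :=
  IsCompactlyContained A (⊤ : Submodule ℂ E)

end HilbertModule

end CompactContainment

end

/-!
A Hilbert `A`-module is a compact element exactly when it has a finite dual frame,
`z = ∑ i, x i ⟨y i, z⟩`. If the identity is compact, then it is within distance less than `1` of
some `F = ∑ i, x i ⟨y i, ·⟩`, so `F` is invertible; as `F⁻¹` is `A`-linear, applying it to the `x i`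
turns `F` into the identity. Conversely, the `x i` of a dual frame generate the module, and the
reconstruction formula writes the identity as a sum of rank-one operators. The elementary tensors
of the vectors of two dual frames form a dual frame of the external tensor product.
-/

namespace HilbertModule

section DualFrame

variable {A E ι : Type*} [NonUnitalCStarAlgebra A] [PartialOrder A] [StarOrderedRing A]
  [NormedAddCommGroup E] [NormedSpace ℂ E] [SMul A E] [CStarModule A E]

theorem mul_smul_eq_smul_smul (a b : A) (x : E) : (a * b) • x = a • b • x :=
  ext_inner A fun z => by simp only [CStarModule.inner_op_smul_right, mul_assoc]

theorem rankOne_apply_smul (x y : E) (a : A) (z : E) :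
    rankOne A x y (a • z) = a • rankOne A x y z := by
  rw [rankOne_apply, rankOne_apply, CStarModule.inner_op_smul_right, mul_smul_eq_smul_smul]

theorem rankOne_smul_left (c : ℂ) (x y : E) : rankOne A (c • x) y = c • rankOne A x y :=
  ContinuousLinearMap.ext fun z => map_smul (act (A := A) (M := E) (inner A y z)) c x

theorem exists_eq_sum_rankOne {F : E →L[ℂ] E}
    (hF : F ∈ Submodule.span ℂ {T | ∃ x y : E, T = rankOne A x y}) :
    ∃ (n : ℕ) (x y : Fin n → E), F = ∑ i, rankOne A (x i) (y i) := by
  obtain ⟨n, c, T, rfl⟩ := Submodule.mem_span_set'.1 hF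
  choose x y hT using fun i => (T i).2
  refine ⟨n, fun i => c i • x i, y, Finset.sum_congr rfl fun i _ => ?_⟩
  rw [hT, rankOne_smul_left]

variable [Fintype ι]

theorem sum_rankOne_apply (x y : ι → E) (z : E) :
    (∑ i, rankOne A (x i) (y i)) z = ∑ i, inner A (y i) z • x i := by
  simp only [sum_apply, rankOne_apply]

theorem sum_rankOne_apply_smul (x y : ι → E) (a : A) (z : E) :
    (∑ i, rankOne A (x i) (y i)) (a • z) = a • (∑ i, rankOne A (x i) (y i)) z := by
  simp only [sum_apply, rankOne_apply_smul]
  exact (map_sum (act (A := A) (M := E) a) _ _).symm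

variable (A) in
/-- The finite families `x` and `y` are a dual pair of frames of the Hilbert `A`-module `E`: they
satisfy the reconstruction formula `z = ∑ i, x i ⟨y i, z⟩`. -/
def IsDualFrame (x y : ι → E) : Prop :=
  ∀ z : E, ∑ i, inner A (y i) z • x i = z

theorem isDualFrame_iff_sum_rankOne_eq_one {x y : ι → E} :
    IsDualFrame A x y ↔ ∑ i, rankOne A (x i) (y i) = 1 := by
  simp only [IsDualFrame, ContinuousLinearMap.ext_iff, sum_rankOne_apply,
    one_apply_eq_self]

theorem exists_isDualFrame_of_isUnit_sum_rankOne {x y : ι → E}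
    (h : IsUnit (∑ i, rankOne A (x i) (y i))) : ∃ x' : ι → E, IsDualFrame A x' y := by
  obtain ⟨u, hu⟩ := h
  let G : E →L[ℂ] E := ↑u⁻¹
  have hG : ∀ z, G ((∑ i, rankOne A (x i) (y i)) z) = z := fun z => by
    rw [← hu]; exact DFunLike.congr_fun u.inv_mul z
  have hG' : ∀ z, (∑ i, rankOne A (x i) (y i)) (G z) = z := fun z => by
    rw [← hu]; exact DFunLike.congr_fun u.mul_inv z
  have hG_smul (a : A) : Function.Semiconj (a • · : E → E) G G :=
    Function.Semiconj.inverses_right (fun z => (sum_rankOne_apply_smul x y a z).symm) hG' hG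
  refine ⟨fun i => G (x i), fun z => ?_⟩
  calc ∑ i, inner A (y i) z • G (x i) = ∑ i, G (inner A (y i) z • x i) :=
        Finset.sum_congr rfl fun i _ => hG_smul _ _
    _ = G ((∑ i, rankOne A (x i) (y i)) z) := by rw [sum_rankOne_apply, map_sum]
    _ = z := hG z

theorem exists_isDualFrame_of_isCompactEndomorphism_one [CompleteSpace E]
    (h : IsCompactEndomorphism A (1 : E →L[ℂ] E)) :
    ∃ (n : ℕ) (x y : Fin n → E), IsDualFrame A x y := by
  obtain ⟨F, hF, hF_near⟩ := Metric.mem_closure_iff.1 h 1 one_pos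
  have hF_unit : IsUnit F := by
    simpa only [sub_sub_cancel] using
      isUnit_one_sub_of_norm_lt_one (x := 1 - F) (by rwa [← dist_eq_norm])
  obtain ⟨n, x, y, rfl⟩ := exists_eq_sum_rankOne hF
  obtain ⟨x', hx'⟩ := exists_isDualFrame_of_isUnit_sum_rankOne hF_unit
  exact ⟨n, x', y, hx'⟩

theorem IsCompactElement.isCompactEndomorphism_one (h : IsCompactElement A E) :
    IsCompactEndomorphism A (1 : E →L[ℂ] E) := by
  obtain ⟨-, -, -, b, hb, -, hb_id⟩ := h
  obtain rfl : b = 1 := ContinuousLinearMap.ext fun x => hb_id x trivial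
  exact hb

theorem IsDualFrame.isCompactEndomorphism_one {x y : ι → E} (h : IsDualFrame A x y) :
    IsCompactEndomorphism A (1 : E →L[ℂ] E) := by
  rw [← isDualFrame_iff_sum_rankOne_eq_one.1 h]
  exact subset_closure (Submodule.sum_mem _ fun i _ => Submodule.subset_span ⟨x i, y i, rfl⟩)

omit [StarOrderedRing A] in
theorem IsDualFrame.isCountablyGenerated_top {x y : ι → E} (h : IsDualFrame A x y) :
    IsCountablyGenerated A (⊤ : Submodule ℂ E) := by
  refine ⟨Set.range x, Set.countable_range x, fun _ _ => trivial, fun z _ => subset_closure ?_⟩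
  rw [SetLike.mem_coe, ← h z]
  exact Submodule.sum_mem _ fun i _ => Submodule.subset_span ⟨_, x i, ⟨i, rfl⟩, rfl⟩

theorem IsDualFrame.isCompactElement {x y : ι → E} (h : IsDualFrame A x y) :
    IsCompactElement A E :=
  ⟨⟨isClosed_univ, fun _ _ _ => trivial⟩, h.isCountablyGenerated_top, h.isCountablyGenerated_top,
    1, h.isCompactEndomorphism_one, fun _ _ => rfl, fun _ _ => rfl⟩

end DualFrame

end HilbertModule

section DualFrameTensor

variable {A B M N : Type*}
  [NonUnitalCStarAlgebra A] [PartialOrder A] [StarOrderedRing A]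
  [NonUnitalCStarAlgebra B] [PartialOrder B] [StarOrderedRing B]
  [NormedAddCommGroup M] [NormedSpace ℂ M] [SMul A M] [CStarModule A M]
  [NormedAddCommGroup N] [NormedSpace ℂ N] [SMul B N] [CStarModule B N]

namespace ExternalTensor

variable (A B M N) in
/-- The elementary tensor `x ⊗ y` in `M ⊗ N` as a bilinear map of `x` and `y`. -/
noncomputable def tmulBilin : M →ₗ[ℂ] N →ₗ[ℂ] ExternalTensor A B M N :=
  (TensorProduct.mk ℂ M N).compr₂ (incl A B M N).toLinearMap

theorem sum_tmul_sum {ι κ : Type*} [Fintype ι] [Fintype κ] (x : ι → M) (y : κ → N) :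
    tmul A B (∑ i, x i) (∑ j, y j) = ∑ p : ι × κ, tmul A B (x p.1) (y p.2) := by
  change tmulBilin A B M N (∑ i, x i) (∑ j, y j) = ∑ p : ι × κ, tmulBilin A B M N (x p.1) (y p.2)
  rw [LinearMap.map_sum₂, Fintype.sum_prod_type]
  simp only [map_sum]

theorem ext_tmul {F : Type*} [NormedAddCommGroup F] [NormedSpace ℂ F]
    {S T : ExternalTensor A B M N →L[ℂ] F}
    (h : ∀ x y, S (tmul A B x y) = T (tmul A B x y)) : S = T :=
  ext_incl fun z => by
    induction z using AlgTensor.induction_on with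
    | zero => simp only [map_zero]
    | tmul x y => exact h x y
    | add z w hz hw => simp only [map_add, hz, hw]

end ExternalTensor

theorem HilbertModule.IsDualFrame.tmul {ι κ : Type*} [Fintype ι] [Fintype κ] {x y : ι → M}
    {x' y' : κ → N} (h : IsDualFrame A x y) (h' : IsDualFrame B x' y') :
    IsDualFrame (MinTensor A B) (fun p : ι × κ => ExternalTensor.tmul A B (x p.1) (x' p.2))
      (fun p : ι × κ => ExternalTensor.tmul A B (y p.1) (y' p.2)) := by
  refine isDualFrame_iff_sum_rankOne_eq_one.2 (ExternalTensor.ext_tmul fun z w => ?_)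
  simp only [sum_rankOne_apply, ExternalTensor.inner_tmul, ExternalTensor.smul_tmul]
  rw [← ExternalTensor.sum_tmul_sum (fun i => inner A (y i) z • x i)
    (fun j => inner B (y' j) w • x' j), h z, h' w, one_apply_eq_self]

end DualFrameTensor

theorem corollary4p1 {A B M₁ M₂ : Type*}
    [NonUnitalCStarAlgebra A] [PartialOrder A] [StarOrderedRing A]
    [NonUnitalCStarAlgebra B] [PartialOrder B] [StarOrderedRing B]
    [NormedAddCommGroup M₁] [NormedSpace ℂ M₁] [CompleteSpace M₁] [SMul A M₁] [CStarModule A M₁]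
    [NormedAddCommGroup M₂] [NormedSpace ℂ M₂] [CompleteSpace M₂] [SMul B M₂] [CStarModule B M₂]
    (h₁ : HilbertModule.IsCompactElement A M₁) (h₂ : HilbertModule.IsCompactElement B M₂) :
    HilbertModule.IsCompactElement (MinTensor A B) (ExternalTensor A B M₁ M₂) := by
  obtain ⟨m, x, y, hxy⟩ :=
    HilbertModule.exists_isDualFrame_of_isCompactEndomorphism_one h₁.isCompactEndomorphism_one
  obtain ⟨n, x', y', hxy'⟩ :=
    HilbertModule.exists_isDualFrame_of_isCompactEndomorphism_one h₂.isCompactEndomorphism_one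
  exact (hxy.tmul hxy').isCompactElement
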